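/- Let $r\ge 1$ be an integer and let $\Psi:\mathbb{R}\to\mathbb{R}$ be bounded and Riemann integrable on every closed interval $[a,b]$. For $V\subset\mathbb{R}^r$ and $\Theta\subset\mathbb{R}$ put $$\mathcal{N}_r(\Psi,V,\Theta)=\mathrm{span}_{\mathbb{R}}\{\mathbb{R}^r\ni x\mapsto \Psi(v^{\mathrm T}x+\theta)\mid v\in V,\ \theta\in\Theta\},\qquad \Sigma^r(\Psi)=\mathcal{N}_r(\Psi,\mathbb{R}^r,\mathbb{R}).$$ A set $S$ of real functions on $\mathbb{R}^r$ is called dense in $C(\mathbb{R}^r)$ for locally uniform convergence if for every nonempty compact $K\subset\mathbb{R}^r$, every continuous $g:K\to\mathbb{R}$ and every $\varepsilon>0$ there is $f\in S$ with $\sup_{x\in K}|f(x)-g(x)|<\varepsilon$. "Almost everywhere" refers to Lebesgue measure. **Theorem.** Let $W\subset\mathbb{R}$ be a set without isolated points with $0\in W$. Let $\mathcal{A}\subset\mathbb{R}^r$ be a set on which no nonzero homogeneous real polynomial in $r$ variables vanishes identically. Let $I\subset\mathbb{R}$ be an open interval (possibly unbounded) on which $\Psi$ does not coincide almost everywhere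 with a polynomial. Then, with $W\mathcal{A}=\{wa\mid w\in W,\ a\in\mathcal{A}\}$, the space $$\mathcal{N}_r(\Psi,W\mathcal{A},I)=\mathrm{span}_{\mathbb{R}}\{x\mapsto\Psi(w\,a^{\mathrm T}x+b)\mid w\in W,\ a\in\mathcal{A},\ b\in I\}$$ is dense in $C(\mathbb{R}^r)$ for locally uniform convergence. **Corollary.** $\Sigma^r(\Psi)$ is dense in $C(\mathbb{R}^r)$ for locally uniform convergence if and only if there is no polynomial function with which $\Psi$ coincides almost everywhere on $\mathbb{R}$. -/

import Mathlib

open MeasureTheory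
open scoped Pointwise Matrix

noncomputable section

/-- `f` is Riemann integrable on the interval `[a, b]` (no condition when `b ≤ a`): Riemann sums over
tagged partitions of `[a, b]` converge as the mesh tends to `0`. A real interval is viewed as a
one-dimensional box. -/
def RiemannIntegrableOn (f : ℝ → ℝ) (a b : ℝ) : Prop :=
  ∀ h : a < b,
    BoxIntegral.Integrable
      (⟨fun _ => a, fun _ => b, fun _ => h⟩ : BoxIntegral.Box (Fin 1))
      BoxIntegral.IntegrationParams.Riemann
      (fun x : Fin 1 → ℝ => f (x 0))
      (volume : Measure (Fin 1 → ℝ)).toBoxAdditive.toSMul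

/-- `f` is bounded and Riemann integrable on every closed interval. -/
def LocallyBoundedRiemannIntegrable (f : ℝ → ℝ) : Prop :=
  ∀ a b : ℝ, (∃ M : ℝ, ∀ x ∈ Set.Icc a b, |f x| ≤ M) ∧ RiemannIntegrableOn f a b

/-- `f` coincides almost everywhere on `S` (for Lebesgue measure) with some real polynomial. -/
def IsAEPolynomialOn (f : ℝ → ℝ) (S : Set ℝ) : Prop :=
  ∃ p : Polynomial ℝ, ∀ᵐ x ∂((volume : Measure ℝ).restrict S), f x = p.eval x

/-- The three-layer feedforward networks: the linear span of `x ↦ Ψ (wᵀ x + θ)`, `w ∈ W`, `θ ∈ Θ`. -/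
def feedforwardNet (r : ℕ) (Ψ : ℝ → ℝ) (W : Set (Fin r → ℝ)) (Θ : Set ℝ) :
    Submodule ℝ ((Fin r → ℝ) → ℝ) :=
  Submodule.span ℝ {f | ∃ w ∈ W, ∃ θ ∈ Θ, f = fun x => Ψ (w ⬝ᵥ x + θ)}

/-- All weights and all thresholds are allowed. -/
def sigmaNet (r : ℕ) (Ψ : ℝ → ℝ) : Submodule ℝ ((Fin r → ℝ) → ℝ) :=
  feedforwardNet r Ψ Set.univ Set.univ

/-- The uniform distance on `K`, valued in `[0, ∞]` because networks need not be continuous. -/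
def uniformDistOn {r : ℕ} (K : Set (Fin r → ℝ)) (f g : (Fin r → ℝ) → ℝ) : ENNReal :=
  ⨆ x ∈ K, ENNReal.ofReal |f x - g x|

/-- Density in `C(ℝ^r)` for locally uniform convergence: for every nonempty compact `K`, every
continuous function on `K` is a uniform limit on `K` of restrictions of members of `S`. -/
def DenseLocallyUniformly {r : ℕ} (S : Set ((Fin r → ℝ) → ℝ)) : Prop :=
  ∀ K : Set (Fin r → ℝ), IsCompact K → K.Nonempty →
    ∀ g : (Fin r → ℝ) → ℝ, ContinuousOn g K →
      ∀ ε : ℝ, 0 < ε → ∃ f ∈ S, uniformDistOn K f g < ENNReal.ofReal ε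

/-- No nonzero homogeneous real polynomial in `r` variables vanishes identically on `A`. -/
def NoHomogeneousVanishing {r : ℕ} (A : Set (Fin r → ℝ)) : Prop :=
  ∀ (k : ℕ) (p : MvPolynomial (Fin r) ℝ), p.IsHomogeneous k →
    (∀ a ∈ A, MvPolynomial.eval a p = 0) → p = 0

end

/-! Density comes from producing every polynomial as a locally uniform limit of networks. For a
smooth compactly supported `φ`, the convolution `F = φ ⋆ Ψ` is smooth, and on compact sets it is a
uniform limit of Riemann sums, which are combinations of translates of `Ψ`
(`comp_convolution_mem_uniformClosureOn`). This rests on Lebesgue's criterion: `Ψ` is continuous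
almost everywhere.

Expanding `F (w a·x + b)` in powers of `w` and letting `w → 0` inside `W` isolates `F⁽ᵏ⁾(b) (a·x)ᵏ`
(`iteratedDeriv_mul_pow_mem_uniformClosureOn`). If for some `k` the factor `F⁽ᵏ⁾(b)` vanished for
all admissible `φ` and `b`, then `Ψ` would be a polynomial almost everywhere on `I`. So each power
`(a·x)ᵏ` is reached; by duality these powers span all polynomials
(`NoHomogeneousVanishing.monomial_mem_span`), and Stone–Weierstrass concludes.

Conversely, if `Ψ` is almost everywhere a polynomial of degree less than `n`, differences of order
`n` annihilate every network almost everywhere, while they send `xᵢⁿ` to `n!`. Since differences are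
stable under uniform approximation, `xᵢⁿ` is out of reach. -/

/-! ### Riemann integrability implies continuity almost everywhere. -/

section LebesgueCriterion

open BoxIntegral Set Filter Topology

variable {ι : Type*} [Fintype ι]

/-- For a Riemann integrable function, the boxes of a fine partition on which the oscillation
exceeds `η` have small total volume. -/
theorem BoxIntegral.Integrable.exists_isPartition_sum_volume_le {f : (ι → ℝ) → ℝ} {I : Box ι}
    (hf : BoxIntegral.Integrable I IntegrationParams.Riemann f
      (volume : Measure (ι → ℝ)).toBoxAdditive.toSMul) {η ε : ℝ} (hη : 0 < η) (hε : 0 < ε) :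
    ∃ π : Prepartition I, π.IsPartition ∧ ∃ s ⊆ π.boxes,
      ∑ J ∈ s, volume.real (J : Set (ι → ℝ)) ≤ ε ∧
      ∀ J ∈ π.boxes, J ∉ s → ∀ y ∈ Box.Icc J, ∀ z ∈ Box.Icc J, f y - f z ≤ η := by
  classical
  -- The Cauchy criterion is applied to two taggings of one partition that differ only on the bad
  -- boxes. The two Riemann sums then differ by at least `η` times the bad volume, hence the
  -- tolerance `η * ε`.
  obtain ⟨r, hr, H⟩ := integrable_iff_cauchy_basis.1 hf (η * ε) (by positivity)
  -- For Riemann integration `r 0` is constant. With half that radius, tags may move anywhere in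
  -- their boxes and the partition stays subordinate to `r 0`.
  let ρ : (ι → ℝ) → Ioi (0 : ℝ) := fun _ =>
    ⟨r 0 0 / 2, mem_Ioi.2 (half_pos (mem_Ioi.1 (r 0 0).2))⟩
  obtain ⟨π, hπ, hπp⟩ := IntegrationParams.Riemann.exists_memBaseSet_isPartition I le_rfl ρ
  let bad : Box ι → Prop := fun J => ∃ y ∈ Box.Icc J, ∃ z ∈ Box.Icc J, η < f y - f z
  have retag : ∀ t : Box ι → ι → ℝ, (∀ J, t J ∈ Box.Icc I) → (∀ J ∈ π, t J ∈ Box.Icc J) →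
      ∃ π' : TaggedPrepartition I, IntegrationParams.Riemann.MemBaseSet I 0 (r 0) π' ∧
        π'.IsPartition ∧ π'.boxes = π.boxes ∧ π'.tag = t := by
    intro t ht htJ
    refine ⟨⟨π.toPrepartition, t, ht⟩, ⟨?_, fun _ => htJ, ?_, ?_⟩, hπp, rfl, rfl⟩
    · intro J hJ x hx
      have h1 := hπ.isSubordinate J hJ hx
      have h2 := hπ.isSubordinate J hJ (htJ J hJ)
      rw [Metric.mem_closedBall] at h1 h2 ⊢
      have h3 : (r 0 (t J) : ℝ) = r 0 0 := by rw [hr 0 rfl (t J)]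
      change dist x (t J) ≤ r 0 (t J)
      have := dist_triangle_right x (t J) (π.tag J)
      simp only [ρ] at h1 h2
      linarith
    · intro h; cases h
    · intro h; cases h
  have hyz : ∀ J, ∃ y z : ι → ℝ, y ∈ Box.Icc I ∧ z ∈ Box.Icc I ∧
      (J ∈ π → y ∈ Box.Icc J ∧ z ∈ Box.Icc J ∧ (bad J → η < f y - f z) ∧ (¬ bad J → y = z)) := by
    intro J
    by_cases hJ : J ∈ π
    · by_cases hb : bad J
      · obtain ⟨y, hy, z, hz, h⟩ := hb
        have hle := Box.le_iff_Icc.1 (π.le_of_mem hJ)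
        exact ⟨y, z, hle hy, hle hz, fun _ =>
          ⟨hy, hz, fun _ => h, fun h' => (h' ⟨y, hy, z, hz, h⟩).elim⟩⟩
      · exact ⟨π.tag J, π.tag J, π.tag_mem_Icc J, π.tag_mem_Icc J, fun _ =>
          ⟨hπ.isHenstock rfl J hJ, hπ.isHenstock rfl J hJ, fun h => (hb h).elim, fun _ => rfl⟩⟩
    · exact ⟨π.tag J, π.tag J, π.tag_mem_Icc J, π.tag_mem_Icc J, fun h => (hJ h).elim⟩
  choose y z hyI hzI hJ using hyz
  obtain ⟨π₁, h₁, hp₁, hb₁, ht₁⟩ := retag y hyI fun J h => (hJ J h).1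
  obtain ⟨π₂, h₂, hp₂, hb₂, ht₂⟩ := retag z hzI fun J h => (hJ J h).2.1
  have hd := H 0 0 π₁ π₂ h₁ hp₁ h₂ hp₂
  simp only [integralSum, hb₁, hb₂, ht₁, ht₂, Real.dist_eq, BoxAdditiveMap.toSMul_apply,
    Measure.toBoxAdditive_apply, smul_eq_mul] at hd
  rw [← Finset.sum_sub_distrib] at hd
  refine ⟨π.toPrepartition, hπp, π.boxes.filter bad, Finset.filter_subset _ _, ?_, ?_⟩
  · have : η * ∑ J ∈ π.boxes.filter bad, volume.real (J : Set (ι → ℝ)) ≤ η * ε := by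
      refine le_trans ?_ ((le_abs_self _).trans hd)
      rw [Finset.mul_sum, Finset.sum_filter]
      refine Finset.sum_le_sum fun J hJm => ?_
      obtain ⟨-, -, h3, h4⟩ := hJ J hJm
      split_ifs with hb
      · nlinarith [h3 hb, measureReal_nonneg (μ := volume) (s := (J : Set (ι → ℝ)))]
      · rw [h4 hb, sub_self]
    exact le_of_mul_le_mul_left this hη
  · intro J hJm hJs y hy z hz
    by_contra! h
    exact hJs (Finset.mem_filter.2 ⟨hJm, y, hy, z, hz, h⟩)

/-- Lebesgue's criterion: a Riemann integrable function is continuous almost everywhere. -/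
theorem BoxIntegral.Integrable.ae_continuousAt {f : (ι → ℝ) → ℝ} {I : Box ι}
    (hf : BoxIntegral.Integrable I IntegrationParams.Riemann f
      (volume : Measure (ι → ℝ)).toBoxAdditive.toSMul) :
    ∀ᵐ x, x ∈ I → ContinuousAt f x := by
  classical
  have key : ∀ n : ℕ, ∀ᵐ x, x ∈ I → oscillation f x ≤ ENNReal.ofReal (1 / (n + 1)) := by
    intro n
    set η : ℝ := 1 / (n + 1)
    have hη : 0 < η := by positivity
    have hsmall : ∀ ε : ℝ, 0 < ε →
        volume {x | ¬ (x ∈ I → oscillation f x ≤ ENNReal.ofReal η)} ≤ ENNReal.ofReal ε := by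
      intro ε hε
      obtain ⟨π, hπ, s, hs, hsum, hgood⟩ := hf.exists_isPartition_sum_volume_le hη hε
      have hnull : volume (⋃ J ∈ π.boxes, Box.Icc J \ Box.Ioo J) = 0 := by
        refine (measure_biUnion_null_iff π.boxes.countable_toSet).2 fun J _ => ?_
        exact (ae_le_set.1 (Box.Ioo_ae_eq_Icc J).symm.le)
      -- Off the bad boxes and the null union of box boundaries, `x` is interior to a box on which
      -- `f` varies by at most `η`.
      have hsub : {x | ¬ (x ∈ I → oscillation f x ≤ ENNReal.ofReal η)} ⊆
          (⋃ J ∈ s, (J : Set (ι → ℝ))) ∪ ⋃ J ∈ π.boxes, Box.Icc J \ Box.Ioo J := by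
        intro x hx
        simp only [mem_ofPred_eq, Classical.not_imp, not_le] at hx
        obtain ⟨hxI, hx⟩ := hx
        obtain ⟨J, hJ, hxJ⟩ := hπ x hxI
        by_cases hJs : J ∈ s
        · exact Or.inl (mem_iUnion₂.2 ⟨J, hJs, hxJ⟩)
        · refine Or.inr (mem_iUnion₂.2 ⟨J, hJ, Box.coe_subset_Icc hxJ, fun hxo => ?_⟩)
          refine absurd hx (not_lt.2 ?_)
          have hopen : IsOpen (Box.Ioo J) := isOpen_set_pi finite_univ fun _ _ => isOpen_Ioo
          have hmem : f '' Box.Icc J ∈ (𝓝 x).map f :=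
            image_mem_map (mem_of_superset (hopen.mem_nhds hxo) (Box.Ioo_subset_Icc J))
          refine (biInf_le _ hmem).trans (Metric.ediam_le ?_)
          rintro _ ⟨y, hy, rfl⟩ _ ⟨z, hz, rfl⟩
          rw [edist_dist, Real.dist_eq]
          exact ENNReal.ofReal_le_ofReal
            (abs_sub_le_iff.2 ⟨hgood J hJ hJs y hy z hz, hgood J hJ hJs z hz y hy⟩)
      calc _ ≤ _ := measure_mono hsub
        _ ≤ _ := measure_union_le _ _
        _ = volume (⋃ J ∈ s, (J : Set (ι → ℝ))) := by rw [hnull, add_zero]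
        _ ≤ ∑ J ∈ s, volume (J : Set (ι → ℝ)) := measure_biUnion_finset_le _ _
        _ = ENNReal.ofReal (∑ J ∈ s, volume.real (J : Set (ι → ℝ))) := by
          rw [ENNReal.ofReal_sum_of_nonneg fun _ _ => measureReal_nonneg]
          exact Finset.sum_congr rfl fun J _ =>
            (ofReal_measureReal (J.measure_coe_lt_top volume).ne).symm
        _ ≤ _ := ENNReal.ofReal_le_ofReal hsum
    rw [ae_iff]
    refine le_antisymm (le_of_forall_pos_le_add fun ε hε => ?_) bot_le
    rcases eq_or_ne ε ⊤ with rfl | hε'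
    · simp
    · have := hsmall ε.toReal (ENNReal.toReal_pos hε.ne' hε')
      rwa [ENNReal.ofReal_toReal hε', ← zero_add ε] at this
  filter_upwards [ae_all_iff.2 key] with x hx hxI
  rw [← Oscillation.eq_zero_iff_continuousAt]
  have ht : Tendsto (fun n : ℕ => ENNReal.ofReal (1 / ((n : ℝ) + 1))) atTop (𝓝 0) := by
    simpa using ENNReal.tendsto_ofReal tendsto_one_div_add_atTop_nhds_zero_nat
  exact le_antisymm (ge_of_tendsto' ht fun n => hx n hxI) bot_le

end LebesgueCriterion

/-! ### Almost everywhere continuity and local integrability of the activation function. -/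

section Activation

open Set Filter Topology

variable {Ψ : ℝ → ℝ}

theorem LocallyBoundedRiemannIntegrable.ae_continuousAt (h : LocallyBoundedRiemannIntegrable Ψ) :
    ∀ᵐ x, ContinuousAt Ψ x := by
  have key : ∀ n : ℕ, ∀ᵐ x : ℝ, x ∈ Ioc (-(n + 1 : ℝ)) (n + 1) → ContinuousAt Ψ x := by
    intro n
    have hn : (-(n + 1 : ℝ)) < n + 1 := by linarith [(Nat.cast_nonneg n : (0 : ℝ) ≤ n)]
    have h1 := ((h (-(n + 1 : ℝ)) (n + 1)).2 hn).ae_continuousAt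
    have h2 := (volume_preserving_funUnique (Fin 1) ℝ).symm.quasiMeasurePreserving.ae h1
    filter_upwards [h2] with x hx hxI
    have hc := hx (by
      intro i
      exact hxI)
    have : Ψ = (fun y : Fin 1 → ℝ => Ψ (y 0)) ∘ fun t : ℝ => fun _ : Fin 1 => t := rfl
    rw [this]
    exact ContinuousAt.comp (x := x) hc (by fun_prop)
  filter_upwards [ae_all_iff.2 key] with x hx
  obtain ⟨n, hn⟩ := exists_nat_gt |x|
  exact hx n ⟨by linarith [neg_abs_le x], by linarith [le_abs_self x]⟩

/-- The continuity points form a Gδ set of full measure, and `Ψ` is continuous on this measurable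
set. -/
theorem aestronglyMeasurable_of_ae_continuousAt (h : ∀ᵐ x, ContinuousAt Ψ x) :
    AEStronglyMeasurable Ψ volume := by
  have hm : MeasurableSet {x | ContinuousAt Ψ x} := (IsGδ.setOfPred_continuousAt Ψ).measurableSet
  rw [← Measure.restrict_eq_self_of_ae_mem h]
  exact ContinuousOn.aestronglyMeasurable
    (fun x hx => ContinuousAt.continuousWithinAt hx) hm

theorem LocallyBoundedRiemannIntegrable.locallyIntegrable
    (h : LocallyBoundedRiemannIntegrable Ψ) : LocallyIntegrable Ψ := by
  rw [MeasureTheory.locallyIntegrable_iff]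
  intro K hK
  obtain ⟨R, hR⟩ := hK.isBounded.subset_closedBall 0
  obtain ⟨M, hM⟩ := (h (-R) R).1
  have hR' : K ⊆ Icc (-R) R := by simpa [Real.closedBall_eq_Icc] using hR
  refine IntegrableOn.of_bound hK.measure_lt_top
    (aestronglyMeasurable_of_ae_continuousAt h.ae_continuousAt).restrict M ?_
  exact (ae_restrict_iff' hK.measurableSet).2 (.of_forall fun x hx => hM x (hR' hx))

end Activation

/-! ### Uniform closure of a space of functions on a set. -/

section UniformClosure

variable {X : Type*} {K : Set X} {S : Submodule ℝ (X → ℝ)}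

/-- The functions that are uniform limits on `K` of members of `S`. -/
def uniformClosureOn (K : Set X) (S : Submodule ℝ (X → ℝ)) : Submodule ℝ (X → ℝ) where
  carrier := {f | ∀ ε : ℝ, 0 < ε → ∃ g ∈ S, ∀ x ∈ K, |g x - f x| ≤ ε}
  zero_mem' := fun ε hε => ⟨0, S.zero_mem, fun x _ => by simpa using hε.le⟩
  add_mem' := by
    intro f₁ f₂ h₁ h₂ ε hε
    obtain ⟨g₁, hg₁, h₁⟩ := h₁ (ε / 2) (half_pos hε)
    obtain ⟨g₂, hg₂, h₂⟩ := h₂ (ε / 2) (half_pos hε)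
    refine ⟨g₁ + g₂, S.add_mem hg₁ hg₂, fun x hx => ?_⟩
    calc |(g₁ + g₂) x - (f₁ + f₂) x| = |(g₁ x - f₁ x) + (g₂ x - f₂ x)| := by
          simp only [Pi.add_apply]; ring_nf
      _ ≤ ε := (abs_add_le _ _).trans (by linarith [h₁ x hx, h₂ x hx])
  smul_mem' := by
    intro c f h ε hε
    obtain ⟨g, hg, h⟩ := h (ε / (|c| + 1)) (by positivity)
    refine ⟨c • g, S.smul_mem c hg, fun x hx => ?_⟩
    simp only [Pi.smul_apply, smul_eq_mul, ← mul_sub, abs_mul]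
    calc |c| * |g x - f x| ≤ (|c| + 1) * (ε / (|c| + 1)) :=
          mul_le_mul (by linarith) (h x hx) (abs_nonneg _) (by positivity)
      _ = ε := by field_simp

/-- Idempotence of the closure; it allows limits of limits, as in the Taylor induction. -/
theorem mem_uniformClosureOn_of_approx {f : X → ℝ}
    (h : ∀ ε : ℝ, 0 < ε → ∃ g ∈ uniformClosureOn K S, ∀ x ∈ K, |g x - f x| ≤ ε) :
    f ∈ uniformClosureOn K S := by
  intro ε hε
  obtain ⟨g, hg, hgf⟩ := h (ε / 2) (half_pos hε)
  obtain ⟨g', hg', hgg⟩ := hg (ε / 2) (half_pos hε)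
  exact ⟨g', hg', fun x hx => (abs_sub_le _ (g x) _).trans (by linarith [hgf x hx, hgg x hx])⟩

end UniformClosure

/-! ### Convolutions as locally uniform limits of Riemann sums. -/

section RiemannSums

open Set Filter Topology Convolution

/-- Writing a finite sum as the integral of a step function makes Riemann sums accessible to
dominated convergence. -/
theorem integral_comp_floor {h : ℤ → ℝ} {s : Finset ℤ} (hs : ∀ i ∉ s, h i = 0) :
    ∫ u : ℝ, h ⌊u⌋ = ∑ i ∈ s, h i := by
  have hpt : ∀ u : ℝ, h ⌊u⌋ = ∑ i ∈ s, (Ico (i : ℝ) (i + 1)).indicator (fun _ => h i) u := by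
    intro u
    have hind : ∀ i : ℤ, (Ico (i : ℝ) (i + 1)).indicator (fun _ => h i) u =
        if i = ⌊u⌋ then h i else 0 := by
      intro i
      by_cases hi : i = ⌊u⌋
      · rw [if_pos hi, indicator_of_mem]
        exact Int.floor_eq_iff.1 hi.symm
      · rw [if_neg hi, indicator_of_notMem]
        exact fun hu => hi (Int.floor_eq_iff.2 hu).symm
    simp only [hind, Finset.sum_ite_eq']
    split_ifs with hu
    · rfl
    · exact hs _ hu
  simp only [hpt]
  rw [integral_finsetSum]
  · refine Finset.sum_congr rfl fun i _ => ?_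
    rw [integral_indicator_const _ measurableSet_Ico]
    simp [measureReal_def]
  · intro i _
    exact (integrable_indicator_iff measurableSet_Ico).2
      (integrableOn_const (by simp))

theorem abs_floor_mul_div_sub_le {n : ℕ} (hn : 0 < n) (t : ℝ) :
    |(⌊n * t⌋ : ℝ) / n - t| ≤ 1 / n := by
  have hn' : (0 : ℝ) < n := by exact_mod_cast hn
  have h1 := Int.floor_le (n * t)
  have h2 := Int.lt_floor_add_one (n * t)
  have : (⌊n * t⌋ : ℝ) / n - t = (⌊n * t⌋ - n * t) / n := by field_simp
  rw [this, abs_div, abs_of_pos hn']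
  refine div_le_div_of_nonneg_right ?_ hn'.le
  rw [abs_le]
  constructor <;> linarith

theorem tendsto_floor_mul_div (t : ℝ) :
    Tendsto (fun n : ℕ => (⌊((n + 1 : ℕ) : ℝ) * t⌋ : ℝ) / ((n + 1 : ℕ) : ℝ)) atTop (𝓝 t) := by
  rw [← tendsto_sub_nhds_zero_iff]
  refine squeeze_zero_norm (fun n => abs_floor_mul_div_sub_le n.succ_pos t) ?_
  simpa using tendsto_one_div_add_atTop_nhds_zero_nat (𝕜 := ℝ)

variable {Ψ φ : ℝ → ℝ}

/-- Step function approximations of `t ↦ φ t * Ψ (s - t)` have integrals that converge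
locally uniformly in `s`. -/
theorem LocallyBoundedRiemannIntegrable.tendstoLocallyUniformly_convolution
    (hΨ : LocallyBoundedRiemannIntegrable Ψ) (hφ : Continuous φ) (hφc : HasCompactSupport φ) :
    TendstoLocallyUniformly
      (fun (n : ℕ) (s : ℝ) => ∫ t : ℝ,
        φ ((⌊((n + 1 : ℕ) : ℝ) * t⌋ : ℝ) / ((n + 1 : ℕ) : ℝ)) *
          Ψ (s - (⌊((n + 1 : ℕ) : ℝ) * t⌋ : ℝ) / ((n + 1 : ℕ) : ℝ)))
      (φ ⋆[ContinuousLinearMap.lsmul ℝ ℝ, volume] Ψ) atTop := by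
  have hcont : Continuous (φ ⋆[ContinuousLinearMap.lsmul ℝ ℝ, volume] Ψ) :=
    hφc.continuous_convolution_left _ hφ hΨ.locallyIntegrable
  rw [tendstoLocallyUniformly_iff_forall_tendsto]
  intro s
  obtain ⟨B, hB⟩ := hφ.bounded_above_of_compact_support hφc
  obtain ⟨M, hM⟩ := hφc.isCompact.isBounded.subset_closedBall 0
  -- The argument stays within `1` of `s`, and sample points where `φ ≠ 0` have size at most `|M|`,
  -- so `C` bounds every relevant value of `Ψ`. The radius `M` may be negative when the support is
  -- empty.
  obtain ⟨C, hC⟩ := (hΨ (-(|s| + 1 + |M|)) (|s| + 1 + |M|)).1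
  have hlim : Tendsto (fun p : ℕ × ℝ => ∫ t : ℝ,
      φ ((⌊((p.1 + 1 : ℕ) : ℝ) * t⌋ : ℝ) / ((p.1 + 1 : ℕ) : ℝ)) *
        Ψ (p.2 - (⌊((p.1 + 1 : ℕ) : ℝ) * t⌋ : ℝ) / ((p.1 + 1 : ℕ) : ℝ)))
      (atTop ×ˢ 𝓝 s) (𝓝 (∫ t : ℝ, φ t * Ψ (s - t))) := by
    refine tendsto_integral_filter_of_dominated_convergence
      ((Icc (-(|M| + 1)) (|M| + 1)).indicator fun _ => B * C) ?_ ?_ ?_ ?_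
    · refine .of_forall fun p => Measurable.aestronglyMeasurable ?_
      exact (measurable_from_top (f := fun i : ℤ => φ ((i : ℝ) / ((p.1 + 1 : ℕ) : ℝ)) *
        Ψ (p.2 - (i : ℝ) / ((p.1 + 1 : ℕ) : ℝ)))).comp
          (Int.measurable_floor.comp (measurable_const_mul _))
    · have hs : ∀ᶠ p : ℕ × ℝ in atTop ×ˢ 𝓝 s, |p.2 - s| < 1 := by
        have : ∀ᶠ s' in 𝓝 s, |s' - s| < 1 := Metric.ball_mem_nhds s one_pos
        exact tendsto_snd.eventually this
      filter_upwards [hs] with p hp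
      refine .of_forall fun t => ?_
      have hq := abs_floor_mul_div_sub_le p.1.succ_pos t
      simp only [Nat.succ_eq_add_one] at hq
      set q : ℝ := (⌊((p.1 + 1 : ℕ) : ℝ) * t⌋ : ℝ) / ((p.1 + 1 : ℕ) : ℝ)
      have hq1 : |q - t| ≤ 1 := hq.trans (by
        rw [div_le_one (by positivity)]; push_cast; linarith [(Nat.cast_nonneg p.1 : (0 : ℝ) ≤ _)])
      by_cases hz : φ q = 0
      · rw [hz, zero_mul, norm_zero]
        refine indicator_nonneg (fun _ _ => ?_) _
        exact mul_nonneg ((norm_nonneg _).trans (hB 0))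
          ((abs_nonneg _).trans (hC 0 ⟨by linarith [abs_nonneg s, abs_nonneg M],
            by linarith [abs_nonneg s, abs_nonneg M]⟩))
      · have hqM : |q| ≤ M := by simpa using hM (subset_tsupport φ hz)
        have hqM' : |q| ≤ |M| := hqM.trans (le_abs_self M)
        have ht : t ∈ Icc (-(|M| + 1)) (|M| + 1) := by
          rw [abs_le] at hq1 hqM'
          constructor <;> linarith [hq1.1, hq1.2, hqM'.1, hqM'.2]
        rw [indicator_of_mem ht, norm_mul]
        refine mul_le_mul (hB q) (hC _ ?_) (norm_nonneg _) ((norm_nonneg _).trans (hB 0))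
        rw [abs_lt] at hp
        rw [abs_le] at hqM'
        constructor <;> linarith [hp.1, hp.2, hqM'.1, hqM'.2, le_abs_self s, neg_abs_le s]
    · exact (integrable_indicator_iff measurableSet_Icc).2 (integrableOn_const (by simp))
    -- Almost everywhere continuity gives convergence of the integrands even though the argument and
    -- the sample point move together.
    · have hae : ∀ᵐ t, ContinuousAt Ψ (s - t) :=
        (Measure.measurePreserving_sub_left volume s).quasiMeasurePreserving.ae hΨ.ae_continuousAt
      filter_upwards [hae] with t ht
      have hq := (tendsto_floor_mul_div t).comp (tendsto_fst (f := atTop) (g := 𝓝 s))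
      exact ((hφ.tendsto t).comp hq).mul (ht.tendsto.comp (tendsto_snd.sub hq))
  -- The limit function is continuous, so both quantities tend to the same value jointly in the
  -- index and the point.
  have h1 : Tendsto (fun p : ℕ × ℝ => (φ ⋆[ContinuousLinearMap.lsmul ℝ ℝ, volume] Ψ) p.2)
      (atTop ×ˢ 𝓝 s) (𝓝 ((φ ⋆[ContinuousLinearMap.lsmul ℝ ℝ, volume] Ψ) s)) :=
    (hcont.tendsto s).comp tendsto_snd
  exact (h1.prodMk_nhds hlim).mono_right (nhds_le_uniformity _)

theorem integral_step_eq_sum (hφc : HasCompactSupport φ) (n : ℕ) :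
    ∃ T : Finset ℤ, ∀ s : ℝ, ∫ t : ℝ,
        φ ((⌊((n + 1 : ℕ) : ℝ) * t⌋ : ℝ) / ((n + 1 : ℕ) : ℝ)) *
          Ψ (s - (⌊((n + 1 : ℕ) : ℝ) * t⌋ : ℝ) / ((n + 1 : ℕ) : ℝ)) =
      ∑ i ∈ T, (φ ((i : ℝ) / ((n + 1 : ℕ) : ℝ)) / ((n + 1 : ℕ) : ℝ)) *
        Ψ (s - (i : ℝ) / ((n + 1 : ℕ) : ℝ)) := by
  have hN : (0 : ℝ) < ((n + 1 : ℕ) : ℝ) := by positivity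
  set N : ℝ := ((n + 1 : ℕ) : ℝ)
  obtain ⟨M, hM⟩ := hφc.isCompact.isBounded.subset_closedBall 0
  refine ⟨Finset.Icc (-⌈M * N⌉) ⌈M * N⌉, fun s => ?_⟩
  -- Rescaling by `N` gives steps of unit length; indices with `|i| > M * N` fall outside the
  -- support of `φ`.
  have h1 := Measure.integral_comp_mul_left
    (fun u : ℝ => φ ((⌊u⌋ : ℝ) / N) * Ψ (s - (⌊u⌋ : ℝ) / N)) N
  have h2 := integral_comp_floor (h := fun i : ℤ => φ ((i : ℝ) / N) * Ψ (s - (i : ℝ) / N))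
    (s := Finset.Icc (-⌈M * N⌉) ⌈M * N⌉) (by
      intro i hi
      by_contra hne
      refine hi ?_
      have hφi : φ ((i : ℝ) / N) ≠ 0 := left_ne_zero_of_mul hne
      have hiM : |(i : ℝ) / N| ≤ M := mem_closedBall_zero_iff.1 (hM (subset_tsupport φ hφi))
      rw [abs_div, abs_of_pos hN, div_le_iff₀ hN] at hiM
      have := abs_le.1 (hiM.trans (Int.le_ceil (M * N)))
      rw [Finset.mem_Icc]
      exact ⟨by exact_mod_cast this.1, by exact_mod_cast this.2⟩)
  rw [h1, h2, abs_of_pos (inv_pos.2 hN), smul_eq_mul, Finset.mul_sum]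
  exact Finset.sum_congr rfl fun i _ => by ring

theorem comp_convolution_mem_uniformClosureOn {r : ℕ} {K : Set (Fin r → ℝ)} (hK : IsCompact K)
    {V : Set (Fin r → ℝ)} {I : Set ℝ}
    (hΨ : LocallyBoundedRiemannIntegrable Ψ) (hφ : Continuous φ) (hφc : HasCompactSupport φ)
    {b : ℝ} (hb : ∀ t, φ t ≠ 0 → b - t ∈ I) {v : Fin r → ℝ} (hv : v ∈ V) :
    (fun x => (φ ⋆[ContinuousLinearMap.lsmul ℝ ℝ, volume] Ψ) (v ⬝ᵥ x + b)) ∈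
      uniformClosureOn K (feedforwardNet r Ψ V I) := by
  intro ε hε
  have hc : Continuous fun x : Fin r → ℝ => v ⬝ᵥ x + b := by
    simp only [dotProduct]; fun_prop
  have hK' := hK.image hc
  have hT := (tendstoLocallyUniformlyOn_iff_tendstoUniformlyOn_of_compact hK').1
    (hΨ.tendstoLocallyUniformly_convolution hφ hφc).tendstoLocallyUniformlyOn
  obtain ⟨n, hn⟩ := ((Metric.tendstoUniformlyOn_iff.1 hT) ε hε).exists
  obtain ⟨T, hT⟩ := integral_step_eq_sum (Ψ := Ψ) hφc n
  refine ⟨∑ i ∈ T, (φ ((i : ℝ) / ((n + 1 : ℕ) : ℝ)) / ((n + 1 : ℕ) : ℝ)) •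
      fun x => Ψ (v ⬝ᵥ x + (b - (i : ℝ) / ((n + 1 : ℕ) : ℝ))), ?_, ?_⟩
  · refine Submodule.sum_mem _ fun i _ => ?_
    -- Samples at zeros of `φ` drop out, so every remaining threshold lies in `I`.
    by_cases hi : φ ((i : ℝ) / ((n + 1 : ℕ) : ℝ)) = 0
    · rw [hi, zero_div, zero_smul]; exact Submodule.zero_mem _
    · exact Submodule.smul_mem _ _ (Submodule.subset_span ⟨v, hv, _, hb _ hi, rfl⟩)
  · intro x hx
    have h := hn _ (mem_image_of_mem _ hx)
    rw [hT, dist_comm, Real.dist_eq] at h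
    simp only [Finset.sum_apply, Pi.smul_apply, smul_eq_mul, ← add_sub_assoc]
    exact h.le

end RiemannSums

/-! ### Extraction of Taylor coefficients. -/

section Taylor

open Set Filter Topology

/-- Taylor coefficients at `0` of `w ↦ g (w * y)` are uniform limits of combinations of values
along any set `W` that accumulates at `0`. -/
theorem iteratedDeriv_mul_pow_mem_uniformClosureOn {X : Type*} {K : Set X}
    {S : Submodule ℝ (X → ℝ)} {g : ℝ → ℝ} (hg : ∀ n : ℕ, ContDiff ℝ n g) {y : X → ℝ} {Y : ℝ}
    (hy : ∀ x ∈ K, |y x| ≤ Y) {W : Set ℝ} (hW : AccPt 0 (𝓟 W))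
    (h : ∀ w ∈ W, (fun x => g (w * y x)) ∈ uniformClosureOn K S) (k : ℕ) :
    (fun x => iteratedDeriv k g 0 * y x ^ k) ∈ uniformClosureOn K S := by
  have main : (fun x => (k.factorial : ℝ)⁻¹ * iteratedDeriv k g 0 * y x ^ k) ∈
      uniformClosureOn K S := by
    induction k using Nat.strong_induction_on with
    | _ k ih =>
    refine mem_uniformClosureOn_of_approx fun ε hε => ?_
    have ho := taylor_isLittleO_univ (x₀ := 0) (hg k)
    have hε' : 0 < ε / (|Y| + 1) ^ k := by positivity
    obtain ⟨δ, hδ, hball⟩ := Metric.eventually_nhds_iff_ball.1 (ho.bound hε')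
    have hδ' : 0 < δ / (|Y| + 1) := by positivity
    obtain ⟨w, ⟨hwδ, hwW⟩, hw0⟩ := accPt_iff_nhds.1 hW _ (Metric.ball_mem_nhds 0 hδ')
    -- The terms of order below `k` are available by induction; once they are subtracted, division
    -- by `w ^ k` leaves the `k`-th term plus an error `o((w * y)ᵏ) / wᵏ`, controlled because `|y| ≤
    -- |Y| + 1`.
    refine ⟨(w ^ k)⁻¹ • ((fun x => g (w * y x)) - ∑ j ∈ Finset.range k,
      (w ^ j) • fun x => (j.factorial : ℝ)⁻¹ * iteratedDeriv j g 0 * y x ^ j),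
      Submodule.smul_mem _ _ (Submodule.sub_mem _ (h w hwW) (Submodule.sum_mem _ fun j hj =>
        Submodule.smul_mem _ _ (ih j (Finset.mem_range.1 hj)))), fun x hx => ?_⟩
    have hyx : |y x| ≤ |Y| + 1 := (hy x hx).trans (by linarith [le_abs_self Y])
    have hwk : w ^ k ≠ 0 := pow_ne_zero _ hw0
    have hmem : w * y x ∈ Metric.ball (0 : ℝ) δ := by
      rw [mem_ball_zero_iff, Real.norm_eq_abs, lt_div_iff₀ (by positivity)] at hwδ
      rw [mem_ball_zero_iff, Real.norm_eq_abs, abs_mul]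
      exact (mul_le_mul_of_nonneg_left hyx (abs_nonneg w)).trans_lt hwδ
    have hb := hball _ hmem
    rw [taylor_within_apply] at hb
    simp only [iteratedDerivWithin_univ, sub_zero, smul_eq_mul, Real.norm_eq_abs] at hb
    rw [Finset.sum_range_succ] at hb
    have heq : ((w ^ k)⁻¹ • ((fun x => g (w * y x)) - ∑ j ∈ Finset.range k,
        (w ^ j) • fun x => (j.factorial : ℝ)⁻¹ * iteratedDeriv j g 0 * y x ^ j)) x -
        (k.factorial : ℝ)⁻¹ * iteratedDeriv k g 0 * y x ^ k =
        (w ^ k)⁻¹ * (g (w * y x) - (∑ j ∈ Finset.range k,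
          (j.factorial : ℝ)⁻¹ * (w * y x) ^ j * iteratedDeriv j g 0 +
          (k.factorial : ℝ)⁻¹ * (w * y x) ^ k * iteratedDeriv k g 0)) := by
      simp only [Pi.smul_apply, Pi.sub_apply, Finset.sum_apply, smul_eq_mul, mul_pow]
      have hs : ∀ j ∈ Finset.range k,
          w ^ j * ((j.factorial : ℝ)⁻¹ * iteratedDeriv j g 0 * y x ^ j) =
          (j.factorial : ℝ)⁻¹ * (w ^ j * y x ^ j) * iteratedDeriv j g 0 := fun j _ => by ring
      rw [Finset.sum_congr rfl hs]
      field_simp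
      ring
    rw [heq, abs_mul, abs_inv]
    refine (mul_le_mul_of_nonneg_left hb (by positivity)).trans ?_
    rw [mul_pow, abs_mul, abs_pow (y x)]
    have hk : |y x| ^ k ≤ (|Y| + 1) ^ k := pow_le_pow_left₀ (abs_nonneg _) hyx k
    have hw' : |w ^ k| ≠ 0 := abs_ne_zero.2 hwk
    calc |w ^ k|⁻¹ * (ε / (|Y| + 1) ^ k * (|w ^ k| * |y x| ^ k))
        = ε / (|Y| + 1) ^ k * |y x| ^ k := by field_simp
      _ ≤ ε / (|Y| + 1) ^ k * (|Y| + 1) ^ k := mul_le_mul_of_nonneg_left hk hε'.le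
      _ = ε := by field_simp
  have := Submodule.smul_mem _ (k.factorial : ℝ) main
  convert this using 1
  ext x
  have : (k.factorial : ℝ) ≠ 0 := by positivity
  simp only [Pi.smul_apply, smul_eq_mul]
  field_simp

end Taylor

/-! ### Powers of linear forms and polynomial approximation. -/

section Polynomials

open MvPolynomial

/-- If no nonzero homogeneous polynomial vanishes on `A`, then the powers of the linear forms with
coefficient vectors in `A` span all homogeneous polynomials. -/
theorem NoHomogeneousVanishing.monomial_mem_span {r : ℕ} {A : Set (Fin r → ℝ)}
    (hA : NoHomogeneousVanishing A) (d : Fin r →₀ ℕ) :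
    monomial d (1 : ℝ) ∈ Submodule.span ℝ
      {p : MvPolynomial (Fin r) ℝ | ∃ a ∈ A, p = (∑ i, C (a i) * X i) ^ d.degree} := by
  classical
  by_contra hd
  -- The functional `f` kills the span but not the monomial. As a function of `a`, `f ((∑ aᵢ Xᵢ)ᵏ)`
  -- is the homogeneous polynomial `q`, which vanishes on `A` and so is zero; yet its coefficient at
  -- `d` is a positive multinomial times `f (monomial d 1)`.
  obtain ⟨f, hf, hfS⟩ := Submodule.exists_dual_map_eq_bot_of_notMem hd inferInstance
  set k := d.degree
  let q : MvPolynomial (Fin r) ℝ := ∑ e ∈ Finset.piAntidiag Finset.univ k,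
    monomial (Finsupp.equivFunOnFinite.symm e)
      ((Nat.multinomial Finset.univ e : ℝ) * f (monomial (Finsupp.equivFunOnFinite.symm e) 1))
  have hq : q.IsHomogeneous k := by
    refine IsHomogeneous.sum _ _ _ fun e he => isHomogeneous_monomial _ ?_
    rw [Finsupp.degree_eq_sum]
    exact (Finset.mem_piAntidiag.1 he).1
  have hmon : ∀ e : Fin r → ℕ, ∀ c : ℝ, ∀ a : Fin r → ℝ,
      eval a (monomial (Finsupp.equivFunOnFinite.symm e) c) = c * ∏ i, a i ^ e i := by
    intro e c a
    rw [eval_monomial, Finsupp.prod_fintype _ _ (by simp)]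
    rfl
  have hexp : ∀ a : Fin r → ℝ, (∑ i, C (a i) * X i : MvPolynomial (Fin r) ℝ) ^ k =
      ∑ e ∈ Finset.piAntidiag Finset.univ k, ((Nat.multinomial Finset.univ e : ℝ) *
        ∏ i, a i ^ e i) • monomial (Finsupp.equivFunOnFinite.symm e) (1 : ℝ) := by
    intro a
    rw [Finset.sum_pow_eq_sum_piAntidiag]
    refine Finset.sum_congr rfl fun e _ => ?_
    rw [monomial_eq, C_1, one_mul, Finsupp.prod_fintype _ _ (by simp), smul_eq_C_mul]
    simp only [mul_pow, Finset.prod_mul_distrib, C_mul, map_prod, map_pow, map_natCast, mul_assoc]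
    rfl
  have hq0 : q = 0 := by
    refine hA k q hq fun a ha => ?_
    have h0 : f ((∑ i, C (a i) * X i) ^ k) = 0 := by
      have : f ((∑ i, C (a i) * X i) ^ k) ∈ Submodule.map f (Submodule.span ℝ
        {p : MvPolynomial (Fin r) ℝ | ∃ a ∈ A, p = (∑ i, C (a i) * X i) ^ k}) :=
        Submodule.mem_map_of_mem (Submodule.subset_span ⟨a, ha, rfl⟩)
      rwa [hfS, Submodule.mem_bot] at this
    rw [hexp, map_sum] at h0
    simp only [q, map_sum, hmon]
    rw [← h0]
    refine Finset.sum_congr rfl fun e _ => ?_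
    rw [map_smul, smul_eq_mul]
    ring
  have hcoeff : coeff d q = (Nat.multinomial Finset.univ d : ℝ) * f (monomial d 1) := by
    simp only [q, coeff_sum, coeff_monomial]
    rw [Finset.sum_eq_single (⇑d)]
    · have : Finsupp.equivFunOnFinite.symm (⇑d) = d := by ext; rfl
      rw [this, if_pos rfl]
    · intro e _ hne
      rw [if_neg]
      rintro rfl
      exact hne rfl
    · intro hd'
      refine absurd ?_ hd'
      rw [Finset.mem_piAntidiag]
      exact ⟨by rw [← Finsupp.degree_eq_sum], fun _ _ => Finset.mem_univ _⟩
  rw [hq0, coeff_zero] at hcoeff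
  refine (mul_ne_zero ?_ hf) hcoeff.symm
  exact_mod_cast (Nat.multinomial_pos _ _).ne'

/-- Evaluation of polynomials, as a linear map into functions. -/
noncomputable def evalFunction (r : ℕ) : MvPolynomial (Fin r) ℝ →ₗ[ℝ] (Fin r → ℝ) → ℝ where
  toFun p x := eval x p
  map_add' p q := by ext; simp
  map_smul' c p := by ext; simp

theorem NoHomogeneousVanishing.eval_mem {r : ℕ} {A : Set (Fin r → ℝ)}
    (hA : NoHomogeneousVanishing A) {S : Submodule ℝ ((Fin r → ℝ) → ℝ)}
    (h : ∀ a ∈ A, ∀ k : ℕ, (fun x => (a ⬝ᵥ x) ^ k) ∈ S) (p : MvPolynomial (Fin r) ℝ) :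
    (fun x => eval x p) ∈ S := by
  suffices p ∈ S.comap (evalFunction r) from this
  rw [p.as_sum]
  refine Submodule.sum_mem _ fun d _ => ?_
  have hle : Submodule.span ℝ {p : MvPolynomial (Fin r) ℝ |
      ∃ a ∈ A, p = (∑ i, C (a i) * X i) ^ d.degree} ≤ S.comap (evalFunction r) := by
    rw [Submodule.span_le]
    rintro _ ⟨a, ha, rfl⟩
    have : evalFunction r ((∑ i, C (a i) * X i) ^ d.degree) = fun x => (a ⬝ᵥ x) ^ d.degree := by
      ext x
      simp [evalFunction, dotProduct]
    change evalFunction r _ ∈ S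
    rw [this]
    exact h a ha _
  have := Submodule.smul_mem _ (coeff d p) (hle (hA.monomial_mem_span d))
  rwa [smul_monomial, smul_eq_mul, mul_one] at this

/-- Stone–Weierstrass for polynomials in `r` variables on a compact set. -/
theorem exists_mvPolynomial_near {r : ℕ} {K : Set (Fin r → ℝ)} (hK : IsCompact K)
    {g : (Fin r → ℝ) → ℝ} (hg : ContinuousOn g K) {ε : ℝ} (hε : 0 < ε) :
    ∃ p : MvPolynomial (Fin r) ℝ, ∀ x ∈ K, |eval x p - g x| < ε := by
  have : CompactSpace K := isCompact_iff_compactSpace.1 hK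
  let F : MvPolynomial (Fin r) ℝ →ₐ[ℝ] C(K, ℝ) :=
    aeval fun i => (⟨fun x => x.1 i, (continuous_apply i).comp continuous_subtype_val⟩ : C(K, ℝ))
  have hF : ∀ p (x : K), F p x = eval x.1 p := by
    intro p x
    induction p using MvPolynomial.induction_on with
    | C c => simp [F]
    | add p q hp hq => simp [hp, hq]
    | mul_X p i hp => simp [hp, F]
  have hsep : F.range.SeparatesPoints := by
    intro x y hxy
    obtain ⟨i, hi⟩ := Function.ne_iff.1 (Subtype.coe_injective.ne hxy)
    refine ⟨F (X i), ⟨F (X i), ⟨X i, rfl⟩, rfl⟩, ?_⟩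
    simpa [hF] using hi
  obtain ⟨⟨_, ⟨p, rfl⟩⟩, hp⟩ :=
    ContinuousMap.exists_mem_subalgebra_near_continuous_of_separatesPoints F.range hsep
      (fun x : K => g x) (continuousOn_iff_continuous_domRestrict.1 hg) ε hε
  exact ⟨p, fun x hx => by simpa [hF] using hp ⟨x, hx⟩⟩

end Polynomials

/-! ### Vanishing distributional derivatives force a polynomial. -/

section VanishingDerivative

open Set Filter Topology Convolution Polynomial

/-- Taylor's formula with zero remainder. The strict degree bound lets `k` nodes determine the
polynomial. -/
theorem exists_polynomial_eqOn_Icc_of_iteratedDeriv_eq_zero {F : ℝ → ℝ}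
    (hF : ∀ n : ℕ, ContDiff ℝ n F) {c d : ℝ} (hcd : c ≤ d) {k : ℕ}
    (h : ∀ y ∈ Icc c d, iteratedDeriv k F y = 0) :
    ∃ p : ℝ[X], p.degree < k ∧ ∀ y ∈ Icc c d, F y = p.eval y := by
  rcases k with - | n
  · exact ⟨0, by simp, fun y hy => by simpa using h y hy⟩
  · refine ⟨∑ j ∈ Finset.range (n + 1),
      C ((j.factorial : ℝ)⁻¹ * iteratedDerivWithin j F (Icc c d) c) * (X - C c) ^ j, ?_, ?_⟩
    · refine (degree_sum_le _ _).trans_lt ((Finset.sup_lt_iff (WithBot.bot_lt_coe _)).2 ?_)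
      intro j hj
      refine (degree_mul_le _ _).trans_lt ((add_le_add_left degree_C_le _).trans_lt ?_)
      rw [zero_add, degree_pow, degree_X_sub_C, nsmul_one]
      exact_mod_cast Finset.mem_range.1 hj
    · intro y hy
      have hb := taylor_mean_remainder_bound (C := 0) (n := n) hcd
        (by exact_mod_cast (hF (n + 1)).contDiffOn) hy (fun z hz => by
          -- On a one-point interval the derivative within it is zero by convention.
          rcases hcd.eq_or_lt with rfl | hlt
          · rw [iteratedDerivWithin_succ, Icc_self, derivWithin_zero_of_not_accPt, norm_zero]
            rw [accPt_iff_frequently_nhdsNE]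
            simp [eventually_nhdsWithin_iff]
            exact .of_forall fun x hx h' => hx (h'.trans (le_antisymm hz.1 hz.2))
          · rw [iteratedDerivWithin_eq_iteratedDeriv (uniqueDiffOn_Icc hlt)
              (hF (n + 1)).contDiffAt hz, h z hz, norm_zero])
      rw [zero_mul, zero_div] at hb
      rw [sub_eq_zero.1 (norm_le_zero_iff.1 hb), taylor_within_apply, eval_finsetSum]
      refine Finset.sum_congr rfl fun j _ => ?_
      simp only [smul_eq_mul, eval_mul, eval_C, eval_pow, eval_sub, eval_X]
      ring

variable {Ψ : ℝ → ℝ}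

theorem LocallyBoundedRiemannIntegrable.contDiff_convolution
    (hΨ : LocallyBoundedRiemannIntegrable Ψ) {φ : ℝ → ℝ} (hφ : ∀ n : ℕ, ContDiff ℝ n φ)
    (hφc : HasCompactSupport φ) (n : ℕ) :
    ContDiff ℝ n (φ ⋆[ContinuousLinearMap.lsmul ℝ ℝ, volume] Ψ) :=
  hφc.contDiff_convolution_left _ (hφ n) hΨ.locallyIntegrable

/-- If the `k`-th derivative of `Ψ` vanishes on `I` in the sense of distributions, then `Ψ` is
almost everywhere a polynomial on `I`. -/
theorem LocallyBoundedRiemannIntegrable.isAEPolynomialOn_of_iteratedDeriv_convolution_eq_zero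
    (hΨ : LocallyBoundedRiemannIntegrable Ψ) {I : Set ℝ} (hI : IsOpen I) (hIc : I.OrdConnected)
    {k : ℕ} (h : ∀ φ : ℝ → ℝ, (∀ n : ℕ, ContDiff ℝ n φ) → HasCompactSupport φ →
      ∀ b, (∀ t, φ t ≠ 0 → b - t ∈ I) →
        iteratedDeriv k (φ ⋆[ContinuousLinearMap.lsmul ℝ ℝ, volume] Ψ) b = 0) :
    IsAEPolynomialOn Ψ I := by
  classical
  rcases I.eq_empty_or_nonempty with rfl | hne
  · exact ⟨0, by simp⟩
  -- Mollifiers with outer radius exactly twice the inner one; a bounded ratio is what almost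
  -- everywhere convergence requires.
  let φ : ℕ → ContDiffBump (0 : ℝ) := fun n =>
    ⟨1 / (n + 1), 2 * (1 / (n + 1)), by positivity, by
      have : (0 : ℝ) < 1 / (n + 1) := by positivity
      linarith⟩
  have hrOut : Tendsto (fun n => (φ n).rOut) atTop (𝓝 0) := by
    have := (tendsto_one_div_add_atTop_nhds_zero_nat (𝕜 := ℝ)).const_mul 2
    rwa [mul_zero] at this
  set F : ℕ → ℝ → ℝ := fun n =>
    ((φ n).normed volume) ⋆[ContinuousLinearMap.lsmul ℝ ℝ, volume] Ψ
  have hF : ∀ n m : ℕ, ContDiff ℝ m (F n) := fun n m =>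
    hΨ.contDiff_convolution (fun _ => (φ n).contDiff_normed) (φ n).hasCompactSupport_normed m
  have hae : ∀ᵐ x, Tendsto (fun n => F n x) atTop (𝓝 (Ψ x)) :=
    ContDiffBump.ae_convolution_tendsto_right_of_locallyIntegrable (K := 2) hrOut
      (.of_forall fun n => le_rfl) hΨ.locallyIntegrable
  set G : Set ℝ := {x | Tendsto (fun n => F n x) atTop (𝓝 (Ψ x))}
  have hinf : (I ∩ G).Infinite := by
    intro hfin
    have h1 : volume (I ∩ G) = 0 := hfin.measure_zero _
    rw [measure_inter_conull' (measure_mono_null (fun x hx => hx.2) hae)] at h1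
    exact (hI.measure_pos volume hne).ne' h1
  -- The nodes are fixed before `n` and `x`, so the interpolants of `F n` converge to a single
  -- polynomial that serves all of `I`.
  obtain ⟨T, hTsub, hTcard⟩ := hinf.exists_subset_card_eq k
  have hid : InjOn (id : ℝ → ℝ) T := Function.injective_id.injOn
  refine ⟨Lagrange.interpolate T id Ψ, (ae_restrict_iff' hI.measurableSet).2 ?_⟩
  filter_upwards [hae] with x hx hxI
  have hlim : Tendsto (fun n => (Lagrange.interpolate T id (F n)).eval x) atTop
      (𝓝 ((Lagrange.interpolate T id Ψ).eval x)) := by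
    simp only [Lagrange.interpolate_apply, eval_finsetSum, eval_mul, eval_C]
    exact tendsto_finsetSum _ fun t ht => (hTsub ht).2.mul_const _
  refine tendsto_nhds_unique (hx.congr' ?_) hlim
  -- The hull of `x` and the nodes is a compact subset of `I`, on which `F n` is eventually a
  -- polynomial of degree below `k`, hence its own interpolant. How large `n` must be may depend on
  -- `x`.
  set U := insert x T
  have hU : U.Nonempty := Finset.insert_nonempty x T
  have hUI : ∀ u ∈ U, u ∈ I := by
    intro u hu
    rcases Finset.mem_insert.1 hu with rfl | hu
    · exact hxI
    · exact (hTsub hu).1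
  have hUicc : ∀ u ∈ U, u ∈ Icc (U.min' hU) (U.max' hU) := fun u hu =>
    ⟨U.min'_le u hu, U.le_max' u hu⟩
  have hsub : Icc (U.min' hU) (U.max' hU) ⊆ I :=
    hIc.out (hUI _ (U.min'_mem hU)) (hUI _ (U.max'_mem hU))
  obtain ⟨δ, hδ, hthick⟩ := isCompact_Icc.exists_thickening_subset_open hI hsub
  filter_upwards [hrOut.eventually (gt_mem_nhds hδ)] with n hn
  obtain ⟨p, hpdeg, hp⟩ := exists_polynomial_eqOn_Icc_of_iteratedDeriv_eq_zero (hF n)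
    (U.min'_le _ (U.max'_mem hU)) (k := k) fun b hb =>
      h _ (fun _ => (φ n).contDiff_normed) (φ n).hasCompactSupport_normed b fun t ht => hthick (by
        have ht' : t ∈ Function.support ((φ n).normed volume) := ht
        rw [(φ n).support_normed_eq, mem_ball_zero_iff] at ht'
        refine Metric.mem_thickening_iff.2 ⟨b, hb, ?_⟩
        rw [dist_eq_norm, sub_sub_cancel_left, norm_neg]
        exact ht'.trans hn)
  rw [hp x (hUicc x (Finset.mem_insert_self x T)),
    Lagrange.eq_interpolate_of_eval_eq (F n) hid (by rwa [hTcard]) fun t ht =>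
      (hp t (hUicc t (Finset.mem_insert_of_mem ht))).symm]

end VanishingDerivative

/-! ### Density of networks. -/

section Density

open Set Filter Topology Convolution

variable {r : ℕ} {Ψ : ℝ → ℝ}

theorem denseLocallyUniformly_feedforwardNet (hΨ : LocallyBoundedRiemannIntegrable Ψ) {W : Set ℝ}
    {A : Set (Fin r → ℝ)} {I : Set ℝ} (hW : AccPt 0 (𝓟 W)) (hA : NoHomogeneousVanishing A)
    (hI : IsOpen I) (hIc : I.OrdConnected) (hpoly : ¬ IsAEPolynomialOn Ψ I) :
    DenseLocallyUniformly (feedforwardNet r Ψ (W • A) I : Set ((Fin r → ℝ) → ℝ)) := by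
  intro K hK _ g hg ε hε
  have hpow : ∀ a ∈ A, ∀ k : ℕ, (fun x => (a ⬝ᵥ x) ^ k) ∈
      uniformClosureOn K (feedforwardNet r Ψ (W • A) I) := by
    intro a ha k
    -- The mollifier and the base point may depend on `k`: only a nonzero factor in front of
    -- `(a·x)ᵏ` is needed.
    have hex : ∃ φ : ℝ → ℝ, (∀ n : ℕ, ContDiff ℝ n φ) ∧ HasCompactSupport φ ∧
        ∃ b, (∀ t, φ t ≠ 0 → b - t ∈ I) ∧
          iteratedDeriv k (φ ⋆[ContinuousLinearMap.lsmul ℝ ℝ, volume] Ψ) b ≠ 0 := by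
      by_contra! hcon
      exact hpoly (hΨ.isAEPolynomialOn_of_iteratedDeriv_convolution_eq_zero hI hIc hcon)
    obtain ⟨φ, hφ, hφc, b, hb, hne⟩ := hex
    set F := φ ⋆[ContinuousLinearMap.lsmul ℝ ℝ, volume] Ψ
    have hF : ∀ n : ℕ, ContDiff ℝ n fun u => F (u + b) := fun n =>
      (hΨ.contDiff_convolution hφ hφc n).comp (contDiff_id.add contDiff_const)
    have hc : Continuous fun x : Fin r → ℝ => a ⬝ᵥ x := by
      simp only [dotProduct]; fun_prop
    obtain ⟨Y, hY⟩ := hK.exists_bound_of_continuousOn hc.continuousOn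
    have hmem := iteratedDeriv_mul_pow_mem_uniformClosureOn (K := K)
      (S := feedforwardNet r Ψ (W • A) I) hF hY hW (fun w hw => by
        simpa only [smul_dotProduct, smul_eq_mul] using
          comp_convolution_mem_uniformClosureOn hK hΨ (hφ 0).continuous hφc hb
            (Set.smul_mem_smul hw ha)) k
    rw [iteratedDeriv_comp_add_const] at hmem
    simp only [zero_add] at hmem
    convert Submodule.smul_mem _ (iteratedDeriv k F b)⁻¹ hmem using 1
    ext x
    simp only [Pi.smul_apply, smul_eq_mul]
    field_simp
  -- Two errors of `ε / 4` bound the supremum by `ε / 2`, which keeps the final inequality strict.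
  obtain ⟨p, hp⟩ := exists_mvPolynomial_near hK hg (show 0 < ε / 4 by positivity)
  obtain ⟨f, hf, hfp⟩ := hA.eval_mem hpow p (ε / 4) (by positivity)
  refine ⟨f, hf, lt_of_le_of_lt (iSup₂_le fun x hx => ENNReal.ofReal_le_ofReal (?_ : _ ≤ ε / 2))
    ((ENNReal.ofReal_lt_ofReal_iff hε).2 (by linarith))⟩
  exact (abs_sub_le _ (MvPolynomial.eval x p) _).trans (by linarith [hfp x hx, hp x hx])

theorem noHomogeneousVanishing_univ : NoHomogeneousVanishing (univ : Set (Fin r → ℝ)) :=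
  fun _ _ _ h => MvPolynomial.funext fun a => by simpa using h a (mem_univ a)

theorem denseLocallyUniformly_sigmaNet (hΨ : LocallyBoundedRiemannIntegrable Ψ)
    (hpoly : ¬ IsAEPolynomialOn Ψ univ) :
    DenseLocallyUniformly (sigmaNet r Ψ : Set ((Fin r → ℝ) → ℝ)) := by
  have h := denseLocallyUniformly_feedforwardNet (r := r) (W := univ) hΨ
    (accPt_iff_nhds.2 fun U hU => by
          obtain ⟨y, hy, hne⟩ := (infinite_of_mem_nhds (0 : ℝ) hU).exists_notMem_finite
            (finite_singleton 0)
          exact ⟨y, ⟨hy, mem_univ _⟩, hne⟩)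
    noHomogeneousVanishing_univ isOpen_univ ordConnected_univ hpoly
  have huniv : (univ : Set ℝ) • (univ : Set (Fin r → ℝ)) = univ :=
    eq_univ_of_forall fun x => ⟨1, mem_univ _, x, mem_univ _, one_smul _ _⟩
  rwa [huniv] at h

end Density

/-! ### Almost everywhere polynomial activations do not give density. -/

section Necessity

open Set Filter Topology

variable {r : ℕ} {Ψ : ℝ → ℝ}

/-- A nonzero linear form is surjective, so it pulls null sets back to null sets. -/
theorem ae_comp_dotProduct_add {w : Fin r → ℝ} (hw : w ≠ 0) (θ : ℝ) {P : ℝ → Prop}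
    (hP : ∀ᵐ y, P y) : ∀ᵐ x : Fin r → ℝ, P (w ⬝ᵥ x + θ) := by
  have h1 : ∀ᵐ y : ℝ, P (y + θ) :=
    (measurePreserving_add_right volume θ).quasiMeasurePreserving.ae hP
  obtain ⟨s, hs, hsm, hsP⟩ := h1.exists_measurable_mem
  let L : (Fin r → ℝ) →ₗ[ℝ] ℝ := dotProductBilin ℝ ℝ w
  have hL : Function.Surjective L := by
    refine LinearMap.surjective fun h0 => hw ?_
    exact dotProduct_self_eq_zero.1 (LinearMap.congr_fun h0 w)
  filter_upwards [(ae_comp_linearMap_mem_iff L volume volume hL hsm).2 hs] with x hx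
  exact hsP _ hx

/-- If `Ψ` is almost everywhere a polynomial, then every network is almost everywhere annihilated
by differences of order exceeding the degree. -/
theorem ae_fwdDiff_iter_eq_zero {p : Polynomial ℝ} (hp : ∀ᵐ y, Ψ y = p.eval y)
    (e : Fin r → ℝ) {f : (Fin r → ℝ) → ℝ} (hf : f ∈ sigmaNet r Ψ) :
    ∀ᵐ x, (fwdDiff e)^[p.natDegree + 1] f x = 0 := by
  unfold sigmaNet feedforwardNet at hf
  induction hf using Submodule.span_induction with
  | mem f hf =>
    obtain ⟨w, -, θ, -, rfl⟩ := hf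
    -- For `w = 0` the value `Ψ θ` may differ from `p.eval θ`, but the unit is constant and a
    -- difference of order at least `1` kills it.
    rcases eq_or_ne w 0 with rfl | hw
    · refine .of_forall fun x => ?_
      rw [fwdDiff_iter_eq_sum_shift]
      have h := congrFun (Polynomial.fwdDiff_iter_eq_zero_of_degree_lt
        (P := Polynomial.C (Ψ θ)) (n := p.natDegree + 1) (by simp)) 0
      rw [fwdDiff_iter_eq_sum_shift] at h
      simpa using h
    · have hall : ∀ k : ℕ, ∀ᵐ x : Fin r → ℝ,
          Ψ (w ⬝ᵥ (x + k • e) + θ) = p.eval (w ⬝ᵥ (x + k • e) + θ) := fun k =>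
        (measurePreserving_add_right volume (k • e)).quasiMeasurePreserving.ae
          (ae_comp_dotProduct_add hw θ hp)
      filter_upwards [ae_all_iff.2 hall] with x hx
      -- This is `p` along the line `t ↦ x + t e`; an affine substitution does not raise the degree.
      let q : Polynomial ℝ := p.comp (Polynomial.C (w ⬝ᵥ e) * Polynomial.X +
        Polynomial.C (w ⬝ᵥ x + θ))
      have hq : q.natDegree < p.natDegree + 1 := by
        refine Nat.lt_succ_of_le (Polynomial.natDegree_comp_le.trans ?_)
        calc _ ≤ p.natDegree * 1 := Nat.mul_le_mul_left _ Polynomial.natDegree_linear_le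
          _ = _ := mul_one _
      have h := congrFun (Polynomial.fwdDiff_iter_eq_zero_of_degree_lt hq) 0
      rw [fwdDiff_iter_eq_sum_shift] at h ⊢
      rw [Pi.zero_apply] at h
      rw [← h]
      refine Finset.sum_congr rfl fun k _ => ?_
      rw [hx k]
      congr 1
      simp only [q, Polynomial.eval_comp, dotProduct_add, dotProduct_smul]
      congr 1
      simp
      ring
  | zero =>
    refine .of_forall fun x => ?_
    rw [fwdDiff_iter_eq_sum_shift]
    simp
  | add f g _ _ hf hg =>
    filter_upwards [hf, hg] with x hfx hgx
    rw [fwdDiff_iter_add, Pi.add_apply, hfx, hgx, add_zero]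
  | smul c f _ hf =>
    filter_upwards [hf] with x hfx
    rw [fwdDiff_iter_const_smul, Pi.smul_apply, hfx, smul_zero]

theorem not_isAEPolynomialOn_of_denseLocallyUniformly (hr : 1 ≤ r)
    (h : DenseLocallyUniformly (sigmaNet r Ψ : Set ((Fin r → ℝ) → ℝ))) :
    ¬ IsAEPolynomialOn Ψ univ := by
  rintro ⟨p, hp⟩
  rw [Measure.restrict_univ] at hp
  set n := p.natDegree + 1
  let i : Fin r := ⟨0, hr⟩
  let g : (Fin r → ℝ) → ℝ := fun x => x i ^ n
  have hg : Continuous g := (continuous_apply i).pow n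
  let e : Fin r → ℝ := fun _ => 1
  -- The cube contains `x + k e` for `x` in the unit cube and `k ≤ n`. The binomial weights sum to
  -- `2 ^ n`, so this tolerance puts the two differences within `1 / 2`, less than `n!`.
  obtain ⟨f, hf, hfg⟩ := h (Icc 0 fun _ => (n : ℝ) + 1) isCompact_Icc
    ⟨0, le_rfl, fun _ => by positivity⟩ g hg.continuousOn (1 / 2 ^ (n + 1)) (by positivity)
  -- The unit cube has positive measure, so it meets the full-measure set where the difference of
  -- `f` vanishes.
  obtain ⟨x, hx, hx0⟩ : ∃ x ∈ Icc (0 : Fin r → ℝ) 1, (fwdDiff e)^[n] f x = 0 := by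
    by_contra! hcon
    have hnull : volume (Icc (0 : Fin r → ℝ) 1) = 0 :=
      measure_mono_null (fun x hx => hcon x hx) (ae_fwdDiff_iter_eq_zero hp e hf)
    rw [Real.volume_Icc_pi] at hnull
    simp at hnull
  have hclose : ∀ k ∈ Finset.range (n + 1), |f (x + k • e) - g (x + k • e)| ≤ 1 / 2 ^ (n + 1) := by
    intro k hk
    have hk' : (k : ℝ) ≤ n := by exact_mod_cast Nat.lt_succ_iff.1 (Finset.mem_range.1 hk)
    have hmem : x + k • e ∈ Icc (0 : Fin r → ℝ) fun _ => (n : ℝ) + 1 := by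
      have hcoord : ∀ j, (x + k • e) j = x j + k := fun j => by simp [e]
      refine ⟨fun j => ?_, fun j => ?_⟩
      · rw [hcoord]
        exact add_nonneg (hx.1 j) k.cast_nonneg
      · rw [hcoord, add_comm]
        exact add_le_add hk' (hx.2 j)
    have hlt := (le_iSup₂ (f := fun y (_ : y ∈ Icc (0 : Fin r → ℝ) fun _ => (n : ℝ) + 1) =>
      ENNReal.ofReal |f y - g y|) _ hmem).trans_lt hfg
    exact ((ENNReal.ofReal_lt_ofReal_iff (by positivity)).1 hlt).le
  have hgn : (fwdDiff e)^[n] g x = n.factorial := by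
    have h1 := congrFun (fwdDiff_iter_eq_factorial (R := ℝ) (n := n)) (x i)
    rw [fwdDiff_iter_eq_sum_shift] at h1 ⊢
    simpa [g, e] using h1
  have hdiff : |(fwdDiff e)^[n] f x - (fwdDiff e)^[n] g x| ≤ 1 / 2 := by
    rw [fwdDiff_iter_eq_sum_shift, fwdDiff_iter_eq_sum_shift, ← Finset.sum_sub_distrib]
    calc _ ≤ ∑ k ∈ Finset.range (n + 1), (n.choose k : ℝ) * (1 / 2 ^ (n + 1)) := by
          refine (Finset.abs_sum_le_sum_abs _ _).trans (Finset.sum_le_sum fun k hk => ?_)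
          rw [← smul_sub, zsmul_eq_mul, abs_mul]
          push_cast
          rw [abs_mul, abs_pow, abs_neg, abs_one, one_pow, one_mul, Nat.abs_cast]
          exact mul_le_mul_of_nonneg_left (hclose k hk) (by positivity)
      _ = 1 / 2 := by
          rw [← Finset.sum_mul, ← Nat.cast_sum, Nat.sum_range_choose]
          rw [Nat.cast_pow, Nat.cast_ofNat, pow_succ 2 n, one_div, mul_inv,
            mul_inv_cancel_left₀ (by positivity), one_div]
  rw [hx0, hgn, zero_sub, abs_neg, Nat.abs_cast] at hdiff
  have : (1 : ℝ) ≤ n.factorial := by exact_mod_cast n.factorial_pos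
  linarith

end Necessity

theorem mainTheorem2 (r : ℕ) (hr : 1 ≤ r) (Ψ : ℝ → ℝ)
    (hΨ : LocallyBoundedRiemannIntegrable Ψ) :
    (∀ (W : Set ℝ) (A : Set (Fin r → ℝ)) (I : Set ℝ),
      (0 : ℝ) ∈ W → Preperfect W →
      NoHomogeneousVanishing A →
      IsOpen I → I.OrdConnected →
      ¬ IsAEPolynomialOn Ψ I →
      DenseLocallyUniformly (feedforwardNet r Ψ (W • A) I : Set ((Fin r → ℝ) → ℝ))) ∧
    (DenseLocallyUniformly (sigmaNet r Ψ : Set ((Fin r → ℝ) → ℝ)) ↔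
      ¬ IsAEPolynomialOn Ψ Set.univ) :=
  ⟨fun _ _ _ h0 hW hA hI hIc hpoly =>
    denseLocallyUniformly_feedforwardNet hΨ (hW 0 h0) hA hI hIc hpoly,
    not_isAEPolynomialOn_of_denseLocallyUniformly hr, denseLocallyUniformly_sigmaNet hΨ⟩
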